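/- Let $A = C^*(x, y \mid x = x^*,\ y = y^*,\ x^2 + y^2 = 1)$ be the universal unital $C^*$-algebra generated by two (not necessarily commuting) self-adjoint elements $x, y$ with $x^2 + y^2 = 1$. For unital $C^*$-algebras $D$ and $B$, let $\mathrm{Hom}(D,B)$ be the set of unital $*$-homomorphisms $D \to B$ with the pointwise norm topology. For $k \geq 1$, a unital $C^*$-algebra $D$ is called strongly unitally contractible modulo $k$ if there are a one-dimensional representation $\rho \in \mathrm{Hom}(D, \mathbb{C})$ and a continuous path in $\mathrm{Hom}(D, D \otimes M_k(\mathbb{C}))$ from the embedding $a \mapsto a \otimes I_k$ to the homomorphism $a \mapsto \rho(a)\,(1 \otimes I_k)$. Then the algebra $A = C^*(x, y \mid x = x^*,\ y = y^*,\ x^2 + y^2 = 1)$ is strongly unitally contractible modulo $2$. -/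

import Mathlib

open scoped TensorProduct

/-- A C*-seminorm on a complex unital *-algebra: a submultiplicative seminorm with
`q (a* a) = q(a)²`. -/
structure CStarSeminorm (P : Type*) [Ring P] [StarRing P] [Algebra ℂ P] extends
    Seminorm ℂ P where
  mul_le' : ∀ a b : P, toSeminorm (a * b) ≤ toSeminorm a * toSeminorm b
  star_mul_self' : ∀ a : P, toSeminorm (star a * a) = toSeminorm a * toSeminorm a

namespace CStarSeminorm

variable {P : Type*} [Ring P] [StarRing P] [Algebra ℂ P]

/-- The algebra `P`, regarded as a seminormed algebra through `q`. -/
def Pre (_q : CStarSeminorm P) : Type _ := P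

variable (q : CStarSeminorm P)

instance : Ring q.Pre := inferInstanceAs (Ring P)
instance : StarRing q.Pre := inferInstanceAs (StarRing P)
instance : Algebra ℂ q.Pre := inferInstanceAs (Algebra ℂ P)
instance [StarModule ℂ P] : StarModule ℂ q.Pre := inferInstanceAs (StarModule ℂ P)

/-- The identity map `P → q.Pre`. -/
def toPre : P ≃⋆ₐ[ℂ] q.Pre where
  toFun a := a
  invFun a := a
  left_inv _ := rfl
  right_inv _ := rfl
  map_mul' _ _ := rfl
  map_add' _ _ := rfl
  map_star' _ := rfl
  map_smul' _ _ := rfl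

noncomputable instance : SeminormedAddCommGroup q.Pre :=
  AddGroupSeminorm.toSeminormedAddCommGroup (E := q.Pre) q.toAddGroupSeminorm

theorem norm_toPre (a : P) : ‖q.toPre a‖ = q.toSeminorm a := rfl

noncomputable instance : SeminormedRing q.Pre where
  __ := (inferInstance : SeminormedAddCommGroup q.Pre)
  __ := (inferInstance : Ring q.Pre)
  norm_mul_le a b := q.mul_le' a b

noncomputable instance : NormedAlgebra ℂ q.Pre where
  norm_smul_le c a := le_of_eq (map_smul_eq_mul q.toSeminorm c (show P from a))

theorem Pre.norm_star_mul_self (a : q.Pre) : ‖star a * a‖ = ‖a‖ * ‖a‖ := q.star_mul_self' a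

theorem Pre.norm_star (a : q.Pre) : ‖star a‖ = ‖a‖ := by
  have key : ∀ a : q.Pre, ‖a‖ ≤ ‖star a‖ := by
    intro a
    by_contra! h
    have h1 := Pre.norm_star_mul_self q a
    have h2 := norm_mul_le (star a) a
    nlinarith [norm_nonneg a, norm_nonneg (star a)]
  refine le_antisymm ?_ (key a)
  simpa using key (star a)

noncomputable instance : NormedStarGroup q.Pre where
  norm_star_le a := (Pre.norm_star q a).le

/-- The C*-algebra obtained from `P` and `q` by separation and completion. -/
abbrev Completion : Type _ := UniformSpace.Completion q.Pre

open UniformSpace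

noncomputable instance : Star q.Completion where
  star := UniformSpace.Completion.map star

theorem continuous_star_completion : Continuous (star : q.Completion → q.Completion) :=
  UniformSpace.Completion.continuous_map

theorem star_coe (a : q.Pre) : star (a : q.Completion) = ((star a : q.Pre) : q.Completion) :=
  UniformSpace.Completion.map_coe (AddMonoidHomClass.isometry_of_norm (starAddEquiv : q.Pre ≃+ q.Pre) (Pre.norm_star q)).uniformContinuous a

noncomputable instance : StarRing q.Completion where
  star_involutive a := by
    induction a using Completion.induction_on with
    | hp => exact isClosed_eq (q.continuous_star_completion.comp q.continuous_star_completion)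
              continuous_id
    | ih a => rw [star_coe, star_coe, star_star]
  star_mul a b := by
    induction a, b using Completion.induction_on₂ with
    | hp =>
      have := q.continuous_star_completion
      exact isClosed_eq (this.comp continuous_mul)
        ((this.comp continuous_snd).mul (this.comp continuous_fst))
    | ih a b => rw [← Completion.coe_mul, star_coe, star_mul, Completion.coe_mul, star_coe, star_coe]
  star_add a b := by
    induction a, b using Completion.induction_on₂ with
    | hp =>
      have := q.continuous_star_completion
      exact isClosed_eq (this.comp continuous_add)
        ((this.comp continuous_fst).add (this.comp continuous_snd))
    | ih a b => rw [← Completion.coe_add, star_coe, star_add, Completion.coe_add, star_coe, star_coe]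

noncomputable instance : NormedAlgebra ℂ q.Completion where
  norm_smul_le := norm_smul_le

noncomputable instance : CStarRing q.Completion where
  norm_mul_self_le a := by
    refine le_of_eq ?_
    induction a using Completion.induction_on with
    | hp =>
      have := q.continuous_star_completion
      exact isClosed_eq (by fun_prop) (by fun_prop)
    | ih a =>
      rw [star_coe, ← Completion.coe_mul, Completion.norm_coe, Completion.norm_coe,
        Pre.norm_star_mul_self]

/-- The canonical *-homomorphism from `P` to the completion. -/
noncomputable def toCompletion : P →⋆ₐ[ℂ] q.Completion where
  toFun a := ((q.toPre a : q.Pre) : q.Completion)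
  map_one' := by rw [map_one, Completion.coe_one]
  map_mul' a b := by rw [map_mul, Completion.coe_mul]
  map_zero' := by rw [map_zero, Completion.coe_zero]
  map_add' a b := by rw [map_add, Completion.coe_add]
  commutes' c := rfl
  map_star' a := by rw [star_coe, map_star]

theorem norm_toCompletion (a : P) : ‖q.toCompletion a‖ = q.toSeminorm a :=
  Completion.norm_coe _

theorem denseRange_toCompletion : DenseRange q.toCompletion :=
  Completion.denseRange_coe (α := q.Pre)


theorem completion_hom_ext {B : Type*} [Ring B] [StarRing B] [Algebra ℂ B] [TopologicalSpace B]
    [T2Space B] {φ ψ : q.Completion →⋆ₐ[ℂ] B} (hφ : Continuous φ) (hψ : Continuous ψ)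
    (h : φ.comp q.toCompletion = ψ.comp q.toCompletion) : φ = ψ := by
  refine DFunLike.coe_injective (q.denseRange_toCompletion.equalizer hφ hψ ?_)
  funext p
  exact DFunLike.congr_fun h p

/-- A *-homomorphism into a C*-algebra that is bounded by `q` extends to the completion. -/
theorem exists_lift {B : Type*} [CStarAlgebra B] (φ : P →⋆ₐ[ℂ] B)
    (hφ : ∀ p, ‖φ p‖ ≤ q.toSeminorm p) :
    ∃ Φ : q.Completion →⋆ₐ[ℂ] B, ∀ p, Φ (q.toCompletion p) = φ p := by
  let f : q.Pre →+* B := (φ : P →+* B).comp (q.toPre.symm : q.Pre →+* P)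
  have hf : Continuous f :=
    AddMonoidHomClass.continuous_of_bound f 1 fun p => by
      rw [one_mul]
      exact hφ (q.toPre.symm p)
  have hc : ∀ p : q.Pre, Completion.extensionHom f hf (p : q.Completion) = f p :=
    Completion.extensionHom_coe f hf
  have hcont : Continuous (Completion.extensionHom f hf) := Completion.continuous_extension
  refine ⟨{ Completion.extensionHom f hf with
    commutes' := ?_
    map_star' := ?_ }, fun p => hc (q.toPre p)⟩
  · intro c
    exact (hc (algebraMap ℂ q.Pre c)).trans (AlgHomClass.commutes φ c)
  · intro a
    change Completion.extensionHom f hf (star a) = star (Completion.extensionHom f hf a)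
    induction a using Completion.induction_on with
    | hp => exact isClosed_eq (hcont.comp q.continuous_star_completion) hcont.star
    | ih a =>
      rw [star_coe, hc, hc]
      exact map_star φ (q.toPre.symm a)

variable [StarModule ℂ P]

noncomputable instance : CStarAlgebra q.Completion where
  star_smul c a := by
    induction a using Completion.induction_on with
    | hp =>
      have := q.continuous_star_completion
      exact isClosed_eq (this.comp (continuous_const_smul c)) (this.const_smul (star c))
    | ih a => rw [← Completion.coe_smul, star_coe, star_smul, Completion.coe_smul, star_coe]

end CStarSeminorm

/-- The free complex unital *-algebra `ℂ⟨x, y⟩` on two self-adjoint generators: noncommutative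
polynomials, with the conjugate-linear involution that reverses words and fixes `x` and `y`. -/
abbrev CirclePoly : Type := ℂ ⊗[ℝ] FreeAlgebra ℝ (Fin 2)

namespace CirclePoly

/-- The generator `x`. -/
noncomputable def x : CirclePoly := 1 ⊗ₜ[ℝ] FreeAlgebra.ι ℝ 0

/-- The generator `y`. -/
noncomputable def y : CirclePoly := 1 ⊗ₜ[ℝ] FreeAlgebra.ι ℝ 1

instance : StarModule ℝ (FreeAlgebra ℝ (Fin 2)) where
  star_smul c p := by
    rw [Algebra.smul_def, star_mul, FreeAlgebra.star_algebraMap, star_trivial c,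
      Algebra.smul_def, Algebra.commutes]

noncomputable instance : StarModule ℂ CirclePoly where
  star_smul c p := by
    induction p using TensorProduct.induction_on with
    | zero => simp
    | tmul d w => simp [TensorProduct.smul_tmul']
    | add p r hp hr => rw [smul_add, star_add, hp, hr, star_add, smul_add]

theorem star_x : star x = x := by simp [x]

theorem star_y : star y = y := by simp [y]

/-- The evaluation of noncommutative polynomials at two self-adjoint elements. -/
theorem exists_eval {B : Type*} [Ring B] [StarRing B] [Algebra ℂ B] [StarModule ℂ B] (a b : B)
    (ha : star a = a) (hb : star b = b) :
    ∃ φ : CirclePoly →⋆ₐ[ℂ] B, φ x = a ∧ φ y = b := by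
  let g : FreeAlgebra ℝ (Fin 2) →ₐ[ℝ] B := FreeAlgebra.lift ℝ ![a, b]
  have hg : ∀ w, g (star w) = star (g w) := by
    intro w
    induction w using FreeAlgebra.induction with
    | grade0 r =>
      rw [FreeAlgebra.star_algebraMap, AlgHomClass.commutes,
        IsScalarTower.algebraMap_apply ℝ ℂ B, ← algebraMap_star_comm]
      simp
    | grade1 i =>
      rw [FreeAlgebra.star_ι, FreeAlgebra.lift_ι_apply]
      fin_cases i <;> simp [ha, hb]
    | mul u v hu hv => rw [star_mul, map_mul, map_mul, star_mul, hu, hv]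
    | add u v hu hv => rw [star_add, map_add, map_add, star_add, hu, hv]
  let G : CirclePoly →ₐ[ℂ] B := AlgHom.liftEquiv ℝ ℂ _ B g
  refine ⟨{ G with map_star' := ?_ }, ?_, ?_⟩
  · intro p
    change G (star p) = star (G p)
    induction p using TensorProduct.induction_on with
    | zero => simp
    | tmul d w =>
      rw [TensorProduct.star_tmul, AlgHom.liftEquiv_tmul, AlgHom.liftEquiv_tmul, hg, star_smul]
    | add p r hp hr => rw [star_add, map_add, map_add, hp, hr, star_add]
  · change G x = a
    simp [G, x, g]
  · change G y = b
    simp [G, y, g]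

theorem induction_on {motive : CirclePoly → Prop} (p : CirclePoly)
    (algebraMap : ∀ c : ℂ, motive (algebraMap ℂ CirclePoly c)) (hx : motive x) (hy : motive y)
    (add : ∀ p r, motive p → motive r → motive (p + r))
    (mul : ∀ p r, motive p → motive r → motive (p * r)) : motive p := by
  have hw : ∀ w : FreeAlgebra ℝ (Fin 2), motive (1 ⊗ₜ[ℝ] w) := by
    intro w
    induction w using FreeAlgebra.induction with
    | grade0 r =>
      have := algebraMap (r : ℂ)
      convert this using 1
      rw [Algebra.TensorProduct.algebraMap_apply, Algebra.algebraMap_eq_smul_one,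
        TensorProduct.tmul_smul, TensorProduct.smul_tmul']
      simp
    | grade1 i =>
      fin_cases i
      · exact hx
      · exact hy
    | mul u v hu hv => simpa using mul _ _ hu hv
    | add u v hu hv => rw [TensorProduct.tmul_add]; exact add _ _ hu hv
  induction p using TensorProduct.induction_on with
  | zero => simpa using algebraMap 0
  | tmul d w => simpa using mul _ _ (algebraMap d) (hw w)
  | add p r hp hr => exact add _ _ hp hr

theorem hom_ext {B : Type*} [Ring B] [StarRing B] [Algebra ℂ B] {φ ψ : CirclePoly →⋆ₐ[ℂ] B}
    (hx : φ x = ψ x) (hy : φ y = ψ y) : φ = ψ := by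
  ext p
  induction p using CirclePoly.induction_on with
  | algebraMap c => rw [AlgHomClass.commutes, AlgHomClass.commutes]
  | hx => exact hx
  | hy => exact hy
  | add p r hp hr => rw [map_add, map_add, hp, hr]
  | mul p r hp hr => rw [map_mul, map_mul, hp, hr]

end CirclePoly

/-- In a C*-algebra, two self-adjoint elements with `a² + b² = 1` are contractions. -/
theorem norm_le_one_of_circle {B : Type*} [CStarAlgebra B] {a b : B} (ha : star a = a)
    (hb : star b = b) (h : a * a + b * b = 1) : ‖a‖ ≤ 1 := by
  let _ : PartialOrder B := CStarAlgebra.spectralOrder B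
  have _ : StarOrderedRing B := CStarAlgebra.spectralOrderedRing B
  have h0 : 0 ≤ a * a := by simpa [ha] using star_mul_self_nonneg a
  have h1 : 0 ≤ b * b := by simpa [hb] using star_mul_self_nonneg b
  have h2 : a * a ≤ 1 := by rw [← h]; exact le_add_of_nonneg_right h1
  have h3 : ‖a * a‖ ≤ 1 := CStarAlgebra.norm_le_one_iff_of_nonneg _ |>.2 h2
  have h4 : ‖a * a‖ = ‖a‖ * ‖a‖ := by simpa [ha] using CStarRing.norm_star_mul_self (x := a)
  nlinarith [norm_nonneg a]

/-- The C*-seminorms on `ℂ⟨x, y⟩` in which the relation `x² + y² = 1` holds. -/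
def circleSeminorms : Set (Seminorm ℂ CirclePoly) :=
  {p | ∃ q : CStarSeminorm CirclePoly, q.toSeminorm = p ∧
    q.toSeminorm (CirclePoly.x * CirclePoly.x + CirclePoly.y * CirclePoly.y - 1) = 0}

theorem circle_relation_of_seminorm (q : CStarSeminorm CirclePoly)
    (hq : q.toSeminorm (CirclePoly.x * CirclePoly.x + CirclePoly.y * CirclePoly.y - 1) = 0) :
    q.toCompletion CirclePoly.x * q.toCompletion CirclePoly.x +
      q.toCompletion CirclePoly.y * q.toCompletion CirclePoly.y = 1 := by
  rw [← sub_eq_zero, ← norm_eq_zero, ← hq, ← q.norm_toCompletion]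
  simp only [map_sub, map_add, map_mul, map_one]

theorem star_toCompletion_x (q : CStarSeminorm CirclePoly) :
    star (q.toCompletion CirclePoly.x) = q.toCompletion CirclePoly.x := by
  rw [← map_star, CirclePoly.star_x]

theorem star_toCompletion_y (q : CStarSeminorm CirclePoly) :
    star (q.toCompletion CirclePoly.y) = q.toCompletion CirclePoly.y := by
  rw [← map_star, CirclePoly.star_y]

theorem bddAbove_circleSeminorms : BddAbove circleSeminorms := by
  rw [Seminorm.bddAbove_iff]
  suffices H : ∀ p : CirclePoly, ∃ C : ℝ, ∀ q ∈ circleSeminorms, q p ≤ C by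
    choose C hC using H
    refine ⟨C, ?_⟩
    rintro _ ⟨q, hq, rfl⟩ p
    exact hC p q hq
  intro p
  induction p using CirclePoly.induction_on with
  | algebraMap c =>
    refine ⟨‖c‖, ?_⟩
    rintro _ ⟨q, rfl, hq⟩
    have h1 : q.toSeminorm 1 * q.toSeminorm 1 = q.toSeminorm 1 := by
      simpa using (q.star_mul_self' 1).symm
    have h2 : q.toSeminorm 1 ≤ 1 := by nlinarith [sq_nonneg (q.toSeminorm 1 - 1)]
    rw [Algebra.algebraMap_eq_smul_one, map_smul_eq_mul]
    exact mul_le_of_le_one_right (norm_nonneg c) h2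
  | hx =>
    refine ⟨1, ?_⟩
    rintro _ ⟨q, rfl, hq⟩
    rw [← q.norm_toCompletion]
    exact norm_le_one_of_circle (star_toCompletion_x q) (star_toCompletion_y q)
      (circle_relation_of_seminorm q hq)
  | hy =>
    refine ⟨1, ?_⟩
    rintro _ ⟨q, rfl, hq⟩
    rw [← q.norm_toCompletion]
    refine norm_le_one_of_circle (star_toCompletion_y q) (star_toCompletion_x q) ?_
    rw [add_comm]
    exact circle_relation_of_seminorm q hq
  | add p r hp hr =>
    obtain ⟨C, hC⟩ := hp
    obtain ⟨D, hD⟩ := hr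
    exact ⟨C + D, fun q hq => (map_add_le_add q p r).trans (add_le_add (hC q hq) (hD q hq))⟩
  | mul p r hp hr =>
    obtain ⟨C, hC⟩ := hp
    obtain ⟨D, hD⟩ := hr
    refine ⟨C * D, ?_⟩
    rintro _ ⟨q, rfl, hq⟩
    have h1 := hC _ ⟨q, rfl, hq⟩
    have h2 := hD _ ⟨q, rfl, hq⟩
    have := apply_nonneg q.toSeminorm p
    have := apply_nonneg q.toSeminorm r
    exact (q.mul_le' p r).trans (mul_le_mul h1 h2 (by assumption) (by linarith))

instance : Nonempty circleSeminorms :=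
  ⟨⟨0, { toSeminorm := 0, mul_le' := by simp, star_mul_self' := by simp }, rfl, rfl⟩⟩

theorem le_sSup_circleSeminorms {q : Seminorm ℂ CirclePoly} (hq : q ∈ circleSeminorms)
    (p : CirclePoly) : q p ≤ sSup circleSeminorms p :=
  le_csSup bddAbove_circleSeminorms hq p

theorem sSup_circleSeminorms_le {p : CirclePoly} {C : ℝ} (h : ∀ q ∈ circleSeminorms, q p ≤ C) :
    sSup circleSeminorms p ≤ C := by
  rw [Seminorm.sSup_apply bddAbove_circleSeminorms]
  exact ciSup_le fun q => h q q.2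

/-- The universal C*-seminorm: the supremum of all C*-seminorms in which `x² + y² = 1`. -/
noncomputable def circleSeminorm : CStarSeminorm CirclePoly where
  toSeminorm := sSup circleSeminorms
  mul_le' a b := by
    refine sSup_circleSeminorms_le ?_
    rintro _ ⟨q, rfl, hq⟩
    exact (q.mul_le' a b).trans (mul_le_mul (le_sSup_circleSeminorms ⟨q, rfl, hq⟩ a)
      (le_sSup_circleSeminorms ⟨q, rfl, hq⟩ b) (apply_nonneg _ _) (apply_nonneg _ _))
  star_mul_self' a := by
    refine le_antisymm (sSup_circleSeminorms_le ?_) ?_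
    · rintro _ ⟨q, rfl, hq⟩
      rw [q.star_mul_self']
      have := le_sSup_circleSeminorms ⟨q, rfl, hq⟩ a
      exact mul_self_le_mul_self (apply_nonneg _ _) this
    · have h : sSup circleSeminorms a ≤ √(sSup circleSeminorms (star a * a)) := by
        refine sSup_circleSeminorms_le ?_
        rintro _ ⟨q, rfl, hq⟩
        refine Real.le_sqrt_of_sq_le ?_
        rw [sq, ← q.star_mul_self']
        exact le_sSup_circleSeminorms ⟨q, rfl, hq⟩ _
      calc sSup circleSeminorms a * sSup circleSeminorms a
          ≤ √(sSup circleSeminorms (star a * a)) * √(sSup circleSeminorms (star a * a)) :=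
            mul_self_le_mul_self (apply_nonneg _ _) h
        _ = sSup circleSeminorms (star a * a) := Real.mul_self_sqrt (apply_nonneg _ _)

/-- The universal C*-algebra `C*(x, y | x = x*, y = y*, x² + y² = 1)`: the completion of `ℂ⟨x, y⟩`
in the universal C*-seminorm. -/
abbrev CircleAlgebra : Type := circleSeminorm.Completion

namespace CircleAlgebra

/-- The generator `x`. -/
noncomputable def x : CircleAlgebra := circleSeminorm.toCompletion CirclePoly.x

/-- The generator `y`. -/
noncomputable def y : CircleAlgebra := circleSeminorm.toCompletion CirclePoly.y

theorem star_x : star x = x := star_toCompletion_x _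

theorem star_y : star y = y := star_toCompletion_y _

theorem relation : x * x + y * y = 1 := by
  refine circle_relation_of_seminorm circleSeminorm
    (le_antisymm (sSup_circleSeminorms_le ?_) (apply_nonneg _ _))
  rintro _ ⟨q, rfl, hq⟩
  exact hq.le

/-- The universal property: unital *-homomorphisms out of the algebra correspond to pairs of
self-adjoint elements with `a² + b² = 1`. -/
theorem existsUnique_hom {B : Type*} [CStarAlgebra B] (a b : B) (ha : star a = a)
    (hb : star b = b) (h : a * a + b * b = 1) :
    ∃! φ : CircleAlgebra →⋆ₐ[ℂ] B, φ x = a ∧ φ y = b := by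
  obtain ⟨φ, hφx, hφy⟩ := CirclePoly.exists_eval a b ha hb
  let q : CStarSeminorm CirclePoly :=
    { toSeminorm := (normSeminorm ℂ B).comp (φ : CirclePoly →ₗ[ℂ] B)
      mul_le' := fun p r => by
        change ‖φ (p * r)‖ ≤ ‖φ p‖ * ‖φ r‖
        rw [map_mul]
        exact norm_mul_le _ _
      star_mul_self' := fun p => by
        change ‖φ (star p * p)‖ = ‖φ p‖ * ‖φ p‖
        rw [map_mul, map_star]
        exact CStarRing.norm_star_mul_self }
  have hq : q.toSeminorm ∈ circleSeminorms := by
    refine ⟨q, rfl, ?_⟩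
    change ‖φ _‖ = 0
    rw [map_sub, map_add, map_mul, map_mul, map_one, hφx, hφy, h, sub_self, norm_zero]
  obtain ⟨Φ, hΦ⟩ := circleSeminorm.exists_lift φ fun p => le_sSup_circleSeminorms hq p
  refine ⟨Φ, ⟨(hΦ _).trans hφx, (hΦ _).trans hφy⟩, ?_⟩
  rintro Ψ ⟨hx, hy⟩
  refine circleSeminorm.completion_hom_ext
    (AddMonoidHomClass.continuous_of_bound Ψ 1 fun a => by
      simpa only [one_mul] using NonUnitalStarAlgHom.norm_apply_le Ψ a)
    (AddMonoidHomClass.continuous_of_bound Φ 1 fun a => by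
      simpa only [one_mul] using NonUnitalStarAlgHom.norm_apply_le Φ a)
    (CirclePoly.hom_ext ?_ ?_)
  · exact hx.trans (hφx.symm.trans (hΦ _).symm)
  · exact hy.trans (hφy.symm.trans (hΦ _).symm)

end CircleAlgebra

/-- The pointwise norm topology on the set `Hom(A, B)` of unital *-homomorphisms. -/
instance StarAlgHom.pointwiseTopology {A B : Type*} [Semiring A] [Algebra ℂ A] [Star A] [Semiring B]
    [Algebra ℂ B] [Star B] [TopologicalSpace B] : TopologicalSpace (A →⋆ₐ[ℂ] B) :=
  TopologicalSpace.induced (fun φ : A →⋆ₐ[ℂ] B => (φ : A → B)) inferInstance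

/-- The diagonal embedding `a ↦ a ⊗ I_k` of `A` into `A ⊗ M_k(ℂ)`, where `A ⊗ M_k(ℂ)` is the
C*-algebra of `k × k` matrices over `A` (its topology is both entrywise convergence and
the topology of the C*-norm). -/
def diagonalEmbedding (A : Type*) [CStarAlgebra A] (k : ℕ) :
    A →⋆ₐ[ℂ] CStarMatrix (Fin k) (Fin k) A where
  toFun a := CStarMatrix.ofMatrix (Matrix.diagonal fun _ => a)
  map_one' := Matrix.diagonal_one
  map_mul' _ _ := (Matrix.diagonal_mul_diagonal _ _).symm
  map_zero' := Matrix.diagonal_zero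
  map_add' _ _ := (Matrix.diagonal_add _ _).symm
  commutes' _ := rfl
  map_star' _ := (Matrix.diagonal_conjTranspose _).symm

/-- A unital C*-algebra `A` is strongly unitally contractible modulo `k` if `a ↦ a ⊗ I_k` lies in
the same path component of `Hom(A, A ⊗ M_k(ℂ))` as a one-dimensional representation
`ρ : A → ℂ ⊆ A ⊗ M_k(ℂ)`. -/
def StronglyUnitallyContractibleMod (A : Type*) [CStarAlgebra A] (k : ℕ) : Prop :=
  ∃ ρ : A →⋆ₐ[ℂ] ℂ,
    Joined (diagonalEmbedding A k) ((StarAlgHom.ofId ℂ (CStarMatrix (Fin k) (Fin k) A)).comp ρ)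

/-! By the universal property, a homomorphism from the algebra to `B` is a point of the
noncommutative circle of `B`: a self-adjoint pair `(a, b)` with `a² + b² = 1`. Norm-continuous paths
of such pairs give pointwise continuous paths of homomorphisms (`joined_of_pairs`), so it is enough
to move `(x ⊗ 1, y ⊗ 1)` to a pair of scalars inside `2 × 2` matrices.

Let `σ = diag(1, -1)` and let `τ` be the flip matrix; both are symmetries and `στ = -τσ`. Plane
rotations preserve `a² + b²` even when `a` and `b` do not commute, so rotating the second diagonal
copy by `π` leads to `(x ⊗ σ, y ⊗ σ)` (`joined_diagonalEmbedding`). The pair `(cos t · x ⊗ σ + sin t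
· 1 ⊗ τ, cos t · y ⊗ σ)` stays on the circle because `x ⊗ σ` and `1 ⊗ τ` anticommute; it ends at `(1
⊗ τ, 0)` (`joined_flip`). Finally `(cos t · τ, sin t · 1)` ends at `(0, 1)` (`joined_scalar`). The
second matrix dimension makes room for the anticommuting symmetry. -/

namespace CircleAlgebra

/-! ### Paths of homomorphisms from paths of pairs -/

section Paths

variable {B : Type*} [CStarAlgebra B]

/-- The homomorphism determined by a pair of self-adjoint elements on the noncommutative circle. -/
noncomputable def homOfPair (a b : B) (ha : star a = a) (hb : star b = b)
    (h : a * a + b * b = 1) : CircleAlgebra →⋆ₐ[ℂ] B :=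
  (existsUnique_hom a b ha hb h).choose

theorem homOfPair_x {a b : B} (ha : star a = a) (hb : star b = b) (h : a * a + b * b = 1) :
    homOfPair a b ha hb h x = a :=
  (existsUnique_hom a b ha hb h).choose_spec.1.1

theorem homOfPair_y {a b : B} (ha : star a = a) (hb : star b = b) (h : a * a + b * b = 1) :
    homOfPair a b ha hb h y = b :=
  (existsUnique_hom a b ha hb h).choose_spec.1.2

theorem hom_ext {φ ψ : CircleAlgebra →⋆ₐ[ℂ] B} (hx : φ x = ψ x) (hy : φ y = ψ y) : φ = ψ := by
  refine (existsUnique_hom (ψ x) (ψ y) ?_ ?_ ?_).unique ⟨hx, hy⟩ ⟨rfl, rfl⟩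
  · rw [← map_star, star_x]
  · rw [← map_star, star_y]
  · rw [← map_mul, ← map_mul, ← map_add, relation, map_one]

/-- A family of homomorphisms is pointwise continuous as soon as it is so on the generators. -/
theorem continuous_hom {T : Type*} [TopologicalSpace T] {φ : T → CircleAlgebra →⋆ₐ[ℂ] B}
    (hx : Continuous fun t => φ t x) (hy : Continuous fun t => φ t y) : Continuous φ := by
  refine continuous_induced_rng.2 (continuous_pi fun a => ?_)
  change Continuous fun t => φ t a
  have hpoly (p : CirclePoly) : Continuous fun t => φ t (circleSeminorm.toCompletion p) := by
    induction p using CirclePoly.induction_on with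
    | algebraMap c => simpa only [AlgHomClass.commutes] using continuous_const
    | hx => exact hx
    | hy => exact hy
    | add p r hp hr =>
      simp only [map_add]
      exact hp.add hr
    | mul p r hp hr =>
      simp only [map_mul]
      exact hp.mul hr
  rw [continuous_iff_continuousAt]
  intro t
  rw [Metric.continuousAt_iff']
  intro ε hε
  obtain ⟨p, hp⟩ := circleSeminorm.denseRange_toCompletion.exists_dist_lt a
    (show 0 < ε / 3 by positivity)
  -- Each `φ s` is contractive, so one polynomial approximates `a` well enough for all parameters
  -- `s` at once.
  have hle (s : T) : dist (φ s a) (φ s (circleSeminorm.toCompletion p)) < ε / 3 := by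
    rw [dist_eq_norm, ← map_sub]
    exact (NonUnitalStarAlgHom.norm_apply_le (φ s) _).trans_lt (by rwa [← dist_eq_norm])
  filter_upwards [Metric.continuousAt_iff'.1 (hpoly p).continuousAt (ε / 3) (by positivity)]
    with s hs
  calc dist (φ s a) (φ t a)
      ≤ dist (φ s a) (φ s (circleSeminorm.toCompletion p)) +
          dist (φ s (circleSeminorm.toCompletion p)) (φ t (circleSeminorm.toCompletion p)) +
          dist (φ t (circleSeminorm.toCompletion p)) (φ t a) := dist_triangle4 _ _ _ _
    _ < ε / 3 + ε / 3 + ε / 3 := by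
        rw [dist_comm _ (φ t a)]
        exact add_lt_add (add_lt_add (hle s) hs) (hle t)
    _ = ε := by ring

/-- Homomorphisms whose values on the generators are joined by a continuous family of pairs of
self-adjoint elements `a, b` with `a² + b² = 1` lie in the same path component. -/
theorem joined_of_pairs {a b : ℝ → B} (ca : Continuous a) (cb : Continuous b)
    (ha : ∀ t, star (a t) = a t) (hb : ∀ t, star (b t) = b t)
    (h : ∀ t, a t * a t + b t * b t = 1) {t₀ t₁ : ℝ} {φ ψ : CircleAlgebra →⋆ₐ[ℂ] B}
    (hφx : φ x = a t₀) (hφy : φ y = b t₀) (hψx : ψ x = a t₁) (hψy : ψ y = b t₁) :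
    Joined φ ψ := by
  let F (t : ℝ) : CircleAlgebra →⋆ₐ[ℂ] B := homOfPair (a t) (b t) (ha t) (hb t) (h t)
  have hF : Continuous F := continuous_hom
    (by simpa only [F, homOfPair_x] using ca) (by simpa only [F, homOfPair_y] using cb)
  have h₀ : F t₀ = φ := hom_ext ((homOfPair_x _ _ _).trans hφx.symm)
    ((homOfPair_y _ _ _).trans hφy.symm)
  have h₁ : F t₁ = ψ := hom_ext ((homOfPair_x _ _ _).trans hψx.symm)
    ((homOfPair_y _ _ _).trans hψy.symm)
  rw [← h₀, ← h₁]
  -- The family is defined on all of `ℝ`, so any two parameters serve as endpoints without rescaling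
  -- to the unit interval.
  exact (PathConnectedSpace.joined t₀ t₁).map hF

end Paths

end CircleAlgebra

/-! ### Calculus of two-by-two matrices -/

section Mat

variable {A : Type*} [CStarAlgebra A]

/-- The `2 × 2` matrix with the given entries, as an element of the C*-algebra `A ⊗ M₂(ℂ)`. -/
def mat₂ (a b c d : A) : CStarMatrix (Fin 2) (Fin 2) A := CStarMatrix.ofMatrix !![a, b; c, d]

theorem mat₂_mul (a b c d a' b' c' d' : A) : mat₂ a b c d * mat₂ a' b' c' d' =
    mat₂ (a * a' + b * c') (a * b' + b * d') (c * a' + d * c') (c * b' + d * d') :=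
  Matrix.mul_fin_two _ _ _ _ _ _ _ _

theorem mat₂_add (a b c d a' b' c' d' : A) : mat₂ a b c d + mat₂ a' b' c' d' =
    mat₂ (a + a') (b + b') (c + c') (d + d') := by
  ext i j; fin_cases i <;> fin_cases j <;> rfl

theorem mat₂_one : mat₂ (1 : A) 0 0 1 = 1 := Matrix.one_fin_two.symm

theorem star_mat₂ (a b c d : A) : star (mat₂ a b c d) =
    mat₂ (star a) (star c) (star b) (star d) := by
  ext i j; fin_cases i <;> fin_cases j <;> rfl

/-- The topology of `CStarMatrix` is the entrywise one, so no estimate of the C*-norm is needed. -/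
theorem continuous_mat₂ {T : Type*} [TopologicalSpace T] {a b c d : T → A} (ha : Continuous a)
    (hb : Continuous b) (hc : Continuous c) (hd : Continuous d) :
    Continuous fun t => mat₂ (a t) (b t) (c t) (d t) := by
  refine continuous_pi fun i => continuous_pi fun j => ?_
  fin_cases i <;> fin_cases j <;> assumption

theorem mat₂_zero : mat₂ (0 : A) 0 0 0 = 0 := by
  ext i j; fin_cases i <;> fin_cases j <;> rfl

theorem diagonalEmbedding_two (a : A) : diagonalEmbedding A 2 a = mat₂ a 0 0 a := by
  ext i j; fin_cases i <;> fin_cases j <;> rfl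

end Mat

/-! ### The three rotations -/

namespace CircleAlgebra

/-- The C*-algebra structure on `CStarMatrix` presupposes an order on the entries, and
`joined_of_pairs` needs that structure on its target. -/
noncomputable instance : PartialOrder CircleAlgebra := CStarAlgebra.spectralOrder _

instance : StarOrderedRing CircleAlgebra := CStarAlgebra.spectralOrderedRing _

/-- Rotating one of the two copies of the noncommutative circle by `π`. -/
theorem joined_diagonalEmbedding
    {ψ : CircleAlgebra →⋆ₐ[ℂ] CStarMatrix (Fin 2) (Fin 2) CircleAlgebra}
    (hx : ψ x = mat₂ x 0 0 (-x)) (hy : ψ y = mat₂ y 0 0 (-y)) :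
    Joined (diagonalEmbedding CircleAlgebra 2) ψ := by
  refine joined_of_pairs (t₀ := 0) (t₁ := Real.pi)
    (a := fun t => mat₂ x 0 0 ((Real.cos t : ℂ) • x + (Real.sin t : ℂ) • y))
    (b := fun t => mat₂ y 0 0 ((-Real.sin t : ℂ) • x + (Real.cos t : ℂ) • y))
    (continuous_mat₂ (by fun_prop) (by fun_prop) (by fun_prop) (by fun_prop))
    (continuous_mat₂ (by fun_prop) (by fun_prop) (by fun_prop) (by fun_prop)) ?_ ?_ ?_ ?_ ?_ ?_ ?_
  · intro t
    -- Keeping the coefficients as casts of real numbers lets `simp` see that conjugation fixes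
    -- them.
    simp [-Complex.ofReal_cos, -Complex.ofReal_sin, star_mat₂, star_x, star_y]
  · intro t
    simp [-Complex.ofReal_cos, -Complex.ofReal_sin, star_mat₂, star_x, star_y]
  · intro t
    have hcs : (Real.cos t : ℂ) * Real.cos t = 1 - (Real.sin t : ℂ) * Real.sin t := by
      push_cast
      linear_combination Complex.sin_sq_add_cos_sq (t : ℂ)
    -- The cross terms `± cos t sin t (xy + yx)` of the two squares cancel, whether or not `x` and
    -- `y` commute.
    have key : ((Real.cos t : ℂ) • x + (Real.sin t : ℂ) • y) *
        ((Real.cos t : ℂ) • x + (Real.sin t : ℂ) • y) +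
        ((-Real.sin t : ℂ) • x + (Real.cos t : ℂ) • y) *
        ((-Real.sin t : ℂ) • x + (Real.cos t : ℂ) • y) = x * x + y * y := by
      simp only [mul_add, add_mul, smul_mul_smul_comm, hcs]
      module
    simp only [mat₂_mul, mat₂_add, mul_zero, zero_mul, add_zero, zero_add, key, relation, mat₂_one]
  · simp [diagonalEmbedding_two]
  · simp [diagonalEmbedding_two]
  · simp [hx]
  · simp [hy]

/-- A pair of the form `x ⊗ σ, y ⊗ σ` can be rotated towards a symmetry anticommuting with `σ`. -/
theorem joined_flip {φ ψ : CircleAlgebra →⋆ₐ[ℂ] CStarMatrix (Fin 2) (Fin 2) CircleAlgebra}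
    (hφx : φ x = mat₂ x 0 0 (-x)) (hφy : φ y = mat₂ y 0 0 (-y))
    (hψx : ψ x = mat₂ 0 1 1 0) (hψy : ψ y = mat₂ 0 0 0 0) : Joined φ ψ := by
  refine joined_of_pairs (t₀ := 0) (t₁ := Real.pi / 2)
    (a := fun t => mat₂ ((Real.cos t : ℂ) • x) ((Real.sin t : ℂ) • 1) ((Real.sin t : ℂ) • 1)
      (-((Real.cos t : ℂ) • x)))
    (b := fun t => mat₂ ((Real.cos t : ℂ) • y) 0 0 (-((Real.cos t : ℂ) • y)))
    (continuous_mat₂ (by fun_prop) (by fun_prop) (by fun_prop) (by fun_prop))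
    (continuous_mat₂ (by fun_prop) (by fun_prop) (by fun_prop) (by fun_prop)) ?_ ?_ ?_ ?_ ?_ ?_ ?_
  · intro t
    simp [-Complex.ofReal_cos, -Complex.ofReal_sin, star_mat₂, star_x]
  · intro t
    simp [-Complex.ofReal_cos, -Complex.ofReal_sin, star_mat₂, star_y]
  · intro t
    have hcs : (Real.sin t : ℂ) * Real.sin t = 1 - (Real.cos t : ℂ) * Real.cos t := by
      push_cast
      linear_combination Complex.sin_sq_add_cos_sq (t : ℂ)
    have key : ((Real.cos t : ℂ) * Real.cos t) • (x * x) +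
        ((Real.sin t : ℂ) * Real.sin t) • (1 : CircleAlgebra) +
        ((Real.cos t : ℂ) * Real.cos t) • (y * y) = 1 := by
      rw [add_right_comm, ← smul_add, relation, hcs]
      module
    rw [mat₂_mul, mat₂_mul, mat₂_add, ← mat₂_one]
    congr 1
    · simpa only [smul_mul_smul_comm, mul_one, mul_zero, add_zero] using key
    -- The off-diagonal entries vanish by the anticommutation of `x ⊗ σ` and `1 ⊗ τ`.
    · simp only [mul_neg, smul_mul_smul_comm, mul_one, one_mul, mul_zero, zero_mul, neg_zero,
        add_zero, mul_comm]
      module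
    · simp only [neg_mul, smul_mul_smul_comm, mul_one, one_mul, mul_zero, zero_mul, add_zero,
        mul_comm]
      module
    · refine Eq.trans ?_ key
      simp only [neg_mul_neg, smul_mul_smul_comm, mul_one, mul_zero, zero_add]
      module
  · simp [hφx]
  · simp [hφy]
  · simp [hψx]
  · simp [hψy]

/-- A symmetry in the first coordinate can be rotated away. -/
theorem joined_scalar {φ ψ : CircleAlgebra →⋆ₐ[ℂ] CStarMatrix (Fin 2) (Fin 2) CircleAlgebra}
    (hφx : φ x = mat₂ 0 1 1 0) (hφy : φ y = mat₂ 0 0 0 0)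
    (hψx : ψ x = mat₂ 0 0 0 0) (hψy : ψ y = mat₂ 1 0 0 1) : Joined φ ψ := by
  refine joined_of_pairs (t₀ := 0) (t₁ := Real.pi / 2)
    (a := fun t => mat₂ 0 ((Real.cos t : ℂ) • (1 : CircleAlgebra)) ((Real.cos t : ℂ) • 1) 0)
    (b := fun t => mat₂ ((Real.sin t : ℂ) • (1 : CircleAlgebra)) 0 0 ((Real.sin t : ℂ) • 1))
    (continuous_mat₂ (by fun_prop) (by fun_prop) (by fun_prop) (by fun_prop))
    (continuous_mat₂ (by fun_prop) (by fun_prop) (by fun_prop) (by fun_prop)) ?_ ?_ ?_ ?_ ?_ ?_ ?_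
  · intro t
    simp [-Complex.ofReal_cos, -Complex.ofReal_sin, star_mat₂]
  · intro t
    simp [-Complex.ofReal_cos, -Complex.ofReal_sin, star_mat₂]
  · intro t
    have hcs : (Real.sin t : ℂ) * Real.sin t = 1 - (Real.cos t : ℂ) * Real.cos t := by
      push_cast
      linear_combination Complex.sin_sq_add_cos_sq (t : ℂ)
    have key : ((Real.cos t : ℂ) * Real.cos t) • (1 : CircleAlgebra) +
        ((Real.sin t : ℂ) * Real.sin t) • 1 = 1 := by
      rw [hcs]
      module
    simp only [mat₂_mul, mat₂_add, smul_mul_smul_comm, mul_zero, zero_mul, add_zero, zero_add,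
      mul_one, key, mat₂_one]
  · simp [hφx]
  · simp [hφy]
  · simp [hψx]
  · simp [hψy]

end CircleAlgebra

open CircleAlgebra in
theorem mainTheorem7 : StronglyUnitallyContractibleMod CircleAlgebra 2 := by
  -- The point `(0, 1)` is where the third path ends, with both coordinates scalar.
  let ρ : CircleAlgebra →⋆ₐ[ℂ] ℂ := homOfPair 0 1 (by simp) (by simp) (by simp)
  have hsq : mat₂ x 0 0 (-x) * mat₂ x 0 0 (-x) + mat₂ y 0 0 (-y) * mat₂ y 0 0 (-y) = 1 := by
    simp [mat₂_mul, mat₂_add, relation, mat₂_one]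
  have hsym : mat₂ (0 : CircleAlgebra) 1 1 0 * mat₂ 0 1 1 0 + mat₂ 0 0 0 0 * mat₂ 0 0 0 0 = 1 := by
    simp [mat₂_mul, mat₂_zero, mat₂_one]
  let φ := homOfPair (mat₂ x 0 0 (-x)) (mat₂ y 0 0 (-y)) (by simp [star_mat₂, star_x])
    (by simp [star_mat₂, star_y]) hsq
  let ψ := homOfPair (mat₂ (0 : CircleAlgebra) 1 1 0) (mat₂ 0 0 0 0) (by simp [star_mat₂])
    (by simp [star_mat₂]) hsym
  refine ⟨ρ, ((joined_diagonalEmbedding (ψ := φ) (homOfPair_x _ _ _) (homOfPair_y _ _ _)).trans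
    (joined_flip (ψ := ψ) (homOfPair_x _ _ _) (homOfPair_y _ _ _) (homOfPair_x _ _ _)
      (homOfPair_y _ _ _))).trans
    (joined_scalar (homOfPair_x _ _ _) (homOfPair_y _ _ _) ?_ ?_)⟩
  · rw [StarAlgHom.comp_apply, show ρ x = 0 from homOfPair_x _ _ _, map_zero, mat₂_zero]
  · rw [StarAlgHom.comp_apply, show ρ y = 1 from homOfPair_y _ _ _, map_one, mat₂_one]
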